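/- Let $N\ge 0$, let $0<r_j<r_j^{(0)}$ for $j=1,\dots,N$, and for a polyradius $\rho$ write $D(\rho)=\{z\in\mathbb C^N: |z_k|<\rho_k \text{ for all } k\}$. (1) Let $\phi_1,\dots,\phi_N$ be holomorphic on $D(r^{(0)})$ and suppose that $|\phi_j(z)|<r_j$ for every $j$ and every $z$ with $|z_k|=r_k$ for all $k$. Then the system $z_j-\phi_j(z)=0$ ($j=1,\dots,N$) has exactly one solution $z$ in $D(r)$; its Jacobian $\det_N\bigl(\delta_{jk}-\partial_{z_k}\phi_j(z)\bigr)$ is nonzero there; and for every $F$ holomorphic on $D(r^{(0)})$ the multiple Lagrange series $$G_N=\sum_{s_1,\dots,s_N=0}^\infty \frac{1}{s_1!\cdots s_N!}\,\prod_{j=1}^N\frac{\partial^{s_j}}{\partial\epsilon_j^{s_j}}\Bigl(\prod_{j=1}^N\phi_j^{s_j}(\epsilon)\cdot F(\epsilon)\Bigr)\Big|_{\epsilon=0}$$ converges absolutely, with sum $$G_N=\frac{F(z)}{\det_N\bigl(\delta_{jk}-\partial_{z_k}\phi_j(z)\bigr)} .$$ (2) In particular, let $\mu_1,\dots,\mu_N\in\mathbb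 C$ and let $\theta$ and $f$ be complex functions such that the functions $\phi_j(\epsilon)=f\bigl(\sum_{a=1}^N\epsilon_a\theta(\mu_a,\mu_j)\bigr)$ satisfy the hypotheses of (1). Then $z_j-f\bigl(\sum_{a}z_a\theta(\mu_a,\mu_j)\bigr)=0$ ($j=1,\dots,N$) has exactly one solution $z$ in $D(r)$, the determinant below is nonzero, and for every $F$ holomorphic on $D(r^{(0)})$ the series $G_N$ converges absolutely with $$G_N=\frac{F(z)}{\det_N\Bigl[\delta_{jk}-\theta(\mu_k,\mu_j)\,f'\bigl(\sum_{a}z_a\theta(\mu_a,\mu_j)\bigr)\Bigr]},$$ where an entry's product $\theta(\mu_k,\mu_j) f'(\cdot)$ is read as $0$ if $\theta(\mu_k,\mu_j)=0$. If moreover $F$ has the form $F(\epsilon)=\mathcal F\bigl(X_1(\epsilon);X_2(\epsilon);\dots\bigr)$ with $$X_m(\epsilon)=\sum_{\substack{a_1,\dots,a_m=1\\ \text{pairwise distinct}}}^N g^{(m)}(\mu_{a_1},\dots,\mu_{a_m})\,\epsilon_{a_1}\cdots\epsilon_{a_m},\qquad m\ge1,$$ for given functions $g^{(m)}$ and $\mathcal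 F$, and is holomorphic on $D(r^{(0)})$, then the numerator is $\mathcal F\bigl(X_1(z);X_2(z);\dots\bigr)$. -/

import Mathlib

namespace LagrangeSeries

noncomputable section

/-- The open polydisc of polyradius `r` centred at the origin of `ℂ^N`. -/
def polydisc {N : ℕ} (r : Fin N → ℝ) : Set (Fin N → ℂ) :=
  {z | ∀ k, ‖z k‖ < r k}

/-- The partial derivative `∂g/∂ε_j`, as a function of the point. -/
def partialDeriv {N : ℕ} (j : Fin N) (g : (Fin N → ℂ) → ℂ) : (Fin N → ℂ) → ℂ :=
  fun z => lineDeriv ℂ g z (Pi.single j 1)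

/-- The mixed partial derivative `∂^{s_1}/∂ε_1^{s_1} ⋯ ∂^{s_N}/∂ε_N^{s_N} g`. -/
def mixedPartial {N : ℕ} (s : Fin N → ℕ) (g : (Fin N → ℂ) → ℂ) : (Fin N → ℂ) → ℂ :=
  (List.finRange N).foldr (fun j h => (partialDeriv j)^[s j] h) g

/-- The term of multi-index `s` of the multiple Lagrange series of `φ_1, …, φ_N` and `F`. -/
def term {N : ℕ} (φ : Fin N → (Fin N → ℂ) → ℂ) (F : (Fin N → ℂ) → ℂ) (s : Fin N → ℕ) : ℂ :=
  (∏ j, (1 / ((s j).factorial : ℂ))) *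
    mixedPartial s (fun ε => (∏ j, φ j ε ^ s j) * F ε) 0

/-- The Jacobian matrix `S_{jk} = δ_{jk} - ∂φ_j/∂z_k` of the system `z_j - φ_j(z) = 0`. -/
def jacobian {N : ℕ} (φ : Fin N → (Fin N → ℂ) → ℂ) (z : Fin N → ℂ) :
    Matrix (Fin N) (Fin N) ℂ :=
  Matrix.of fun j k => (if j = k then 1 else 0) - partialDeriv k (φ j) z

/-- The linear form `∑_a ε_a θ(μ_a, μ_j)`. -/
def linForm {N : ℕ} (θ : ℂ → ℂ → ℂ) (μ : Fin N → ℂ) (j : Fin N) (ε : Fin N → ℂ) : ℂ :=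
  ∑ a, ε a * θ (μ a) (μ j)

/-- The sequence of sums
`∑_a g⁽¹⁾(μ_a) ε_a`, `∑_{a ≠ b} g⁽²⁾(μ_a, μ_b) ε_a ε_b`, …;
the entry of index `m` is the sum over `(m+1)`-tuples of pairwise distinct indices. -/
def structArg {N : ℕ} (μ : Fin N → ℂ) (g : (m : ℕ) → (Fin (m + 1) → ℂ) → ℂ)
    (ε : Fin N → ℂ) : ℕ → ℂ :=
  fun m => ∑ e : Fin (m + 1) ↪ Fin N, g m (fun i => μ (e i)) * ∏ i, ε (e i)

end

end LagrangeSeries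

/-! Cauchy's formula on the torus |ε_k| = r_k turns the term of multi-index s into the normalised
integral of F ∏ φ_j^{s_j} / ε_j^{s_j+1} (`mixedPartial_eq_torusAvg`). By compactness each |φ_j/ε_j|
is bounded there by a constant below 1, so the multiple geometric series can be summed under the
integral (`hasSum_torusAvg`), and G_N is the integral of F / ∏ (ε_j - φ_j). It remains to find the
fixed point and to evaluate this integral as a residue at it.

Both are done by one induction on the dimension (`exists_isResidualPoint`). With the first
coordinate x frozen, the other equations have a unique solution ζ(x), and substituting it leaves the
single equation x = φ_0(x, ζ(x)), settled by `fixedPoint_disc`. Holomorphy of ζ needs no implicit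
function theorem: with D the inner Jacobian determinant, the inner residue integrals of numerators
z_k and 1 equal ζ_k/D and 1/D; they are holomorphic in x as parameter integrals, and ζ_k is their
quotient. The chain rule along x ↦ (x, ζ(x)) factors the full Jacobian determinant.

In one variable, zero counting is replaced by a minimum principle: a positive real part on the
circle forces a positive real part inside. -/

namespace LagrangeSeries

open Filter Topology Metric Complex Set MeasureTheory Matrix
open scoped Real

variable {n : ℕ}

/-! ### Minimum principle for real parts -/

/-- A function with positive real part on a circle has positive real part inside. -/
lemma re_pos_of_re_pos_sphere {q : ℂ → ℂ} {r : ℝ} (hr : 0 < r)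
    (hq : DiffContOnCl ℂ q (ball 0 r)) (h : ∀ x ∈ sphere (0 : ℂ) r, 0 < (q x).re) :
    ∀ x ∈ closedBall (0 : ℂ) r, 0 < (q x).re := by
  intro x hx
  have hcl : closure (ball (0 : ℂ) r) = closedBall 0 r := closure_ball _ hr.ne'
  have hcont : ContinuousOn (fun y => (q y).re) (sphere (0 : ℂ) r) :=
    continuous_re.comp_continuousOn (hq.continuousOn.mono (hcl ▸ sphere_subset_closedBall))
  obtain ⟨x₀, hx₀, hmin⟩ := (isCompact_sphere (0 : ℂ) r).exists_isMinOn
    (NormedSpace.sphere_nonempty.2 hr.le) hcont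
  -- Since |exp(-q)| = exp(-Re q), the maximum principle for exp(-q) is a minimum principle for Re
  -- q.
  have he : Differentiable ℂ fun w : ℂ => Complex.exp (-w) := by fun_prop
  have hd : DiffContOnCl ℂ (fun y => Complex.exp (-q y)) (ball 0 r) := he.comp_diffContOnCl hq
  have key := norm_le_of_forall_mem_frontier_norm_le isBounded_ball hd
    (C := Real.exp (-(q x₀).re)) (fun z hz => by
      rw [frontier_ball _ hr.ne'] at hz
      rw [norm_exp, neg_re]
      exact Real.exp_le_exp.2 (neg_le_neg (hmin hz))) (hcl.symm ▸ hx)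
  rw [norm_exp, neg_re, Real.exp_le_exp] at key
  linarith [h x₀ hx₀]

/-! ### Calculus of functions holomorphic near a set -/

/-- `f` is complex differentiable in a neighbourhood of `K`. -/
def HolNear {E : Type*} [NormedAddCommGroup E] [NormedSpace ℂ E] (f : E → ℂ) (K : Set E) : Prop :=
  ∀ᶠ x in 𝓝ˢ K, DifferentiableAt ℂ f x

namespace HolNear

variable {E : Type*} [NormedAddCommGroup E] [NormedSpace ℂ E] {f g : E → ℂ} {K : Set E}

lemma differentiableAt (hf : HolNear f K) {x : E} (hx : x ∈ K) : DifferentiableAt ℂ f x :=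
  Eventually.self_of_nhdsSet hf x hx

lemma mono {K' : Set E} (hf : HolNear f K) (h : K' ⊆ K) : HolNear f K' :=
  Filter.Eventually.filter_mono (nhdsSet_mono h) hf

lemma continuousOn (hf : HolNear f K) : ContinuousOn f K := fun _ hx =>
  (hf.differentiableAt hx).continuousAt.continuousWithinAt

lemma mul (hf : HolNear f K) (hg : HolNear g K) : HolNear (fun x => f x * g x) K := by
  filter_upwards [hf, hg] with x h1 h2 using h1.mul h2

lemma sub (hf : HolNear f K) (hg : HolNear g K) : HolNear (fun x => f x - g x) K := by
  filter_upwards [hf, hg] with x h1 h2 using h1.sub h2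

lemma pow (hf : HolNear f K) (n : ℕ) : HolNear (fun x => f x ^ n) K := by
  filter_upwards [hf] with x h1 using h1.pow n

lemma prod {ι : Type*} [Fintype ι] {f : ι → E → ℂ} (hf : ∀ i, HolNear (f i) K) :
    HolNear (fun x => ∏ i, f i x) K := by
  classical
  filter_upwards [eventually_all.2 hf] with x h1
  simpa only [Finset.prod_apply] using
    (HasFDerivAt.finsetProd (u := Finset.univ) fun i _ => (h1 i).hasFDerivAt).differentiableAt

lemma eventually_ne_zero (hf : HolNear f K) (h0 : ∀ x ∈ K, f x ≠ 0) :
    ∀ᶠ x in 𝓝ˢ K, f x ≠ 0 :=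
  eventually_nhdsSet_iff_forall.2 fun x hx =>
    (hf.differentiableAt hx).continuousAt.eventually_ne (h0 x hx)

lemma div (hf : HolNear f K) (hg : HolNear g K) (h0 : ∀ x ∈ K, g x ≠ 0) :
    HolNear (fun x => f x / g x) K := by
  filter_upwards [hf, hg, hg.eventually_ne_zero h0] with x h1 h2 h3
  simp only [div_eq_mul_inv]
  exact h1.mul ((differentiableAt_inv h3).comp x h2)

lemma of_differentiable (hf : Differentiable ℂ f) : HolNear f K := Eventually.of_forall hf

lemma comp {E' : Type*} [NormedAddCommGroup E'] [NormedSpace ℂ E'] {K' : Set E'} {u : E' → E}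
    (hf : HolNear f K) (hu : Differentiable ℂ u) (h : MapsTo u K' K) :
    HolNear (fun x => f (u x)) K' := by
  filter_upwards [hu.continuous.tendsto_nhdsSet h hf] with x hx using hx.comp x (hu x)

lemma diffContOnCl {f : ℂ → ℂ} {r : ℝ} (hr : 0 < r) (hf : HolNear f (closedBall 0 r)) :
    DiffContOnCl ℂ f (ball 0 r) where
  differentiableOn x hx := (hf.differentiableAt (ball_subset_closedBall hx)).differentiableWithinAt
  continuousOn := by rw [closure_ball _ hr.ne']; exact hf.continuousOn

lemma dslope {f : ℂ → ℂ} {K : Set ℂ} (hf : HolNear f K) (z : ℂ)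
    (hz : z ∈ K) : HolNear (_root_.dslope f z) K := by
  obtain ⟨U, hU, hKU, hd⟩ := eventually_nhdsSet_iff_exists.1 hf
  have h1 : DifferentiableOn ℂ f U := fun x hx => (hd x hx).differentiableWithinAt
  have h2 := (Complex.differentiableOn_dslope (hU.mem_nhds (hKU hz))).2 h1
  exact eventually_nhdsSet_iff_exists.2
    ⟨U, hU, hKU, fun x hx => h2.differentiableAt (hU.mem_nhds hx)⟩

end HolNear

/-! ### The fixed point in a disc -/

/-- Re(w·conj x) ≤ |w| r, which is smaller than r² = x·conj x. This is how the strict bound on φ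
enters the one-variable argument. -/
lemma re_mul_conj_sub_pos {x w : ℂ} {r : ℝ} (hx : ‖x‖ = r) (hw : ‖w‖ < r) :
    0 < ((x - w) * (starRingEnd ℂ) x).re := by
  have h1 : (w * (starRingEnd ℂ) x).re ≤ ‖w‖ * r := by
    refine (re_le_norm _).trans ?_
    rw [norm_mul, Complex.norm_conj, hx]
  have h2 : (x * (starRingEnd ℂ) x).re = r ^ 2 := by
    rw [mul_conj, ofReal_re, normSq_eq_norm_sq, hx]
  rw [sub_mul, sub_re, h2]
  nlinarith [norm_nonneg w]

/-- A holomorphic function mapping a circle strictly inside has exactly one fixed point in the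
disc, which is simple, and the residue there computes the Cauchy-type integral. -/
lemma fixedPoint_disc {φ : ℂ → ℂ} {r : ℝ} (hr : 0 < r) (hφ : HolNear φ (closedBall 0 r))
    (hb : ∀ x ∈ sphere (0 : ℂ) r, ‖φ x‖ < r) :
    ∃ z ∈ ball (0 : ℂ) r, φ z = z ∧ (∀ w ∈ closedBall (0 : ℂ) r, φ w = w → w = z) ∧
      1 - deriv φ z ≠ 0 ∧ ∀ F : ℂ → ℂ, HolNear F (closedBall 0 r) →
        (2 * π * I)⁻¹ * ∮ x in C(0, r), F x / (x - φ x) = F z / (1 - deriv φ z) := by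
  have hid : HolNear (fun x : ℂ => x) (closedBall 0 r) := .of_differentiable differentiable_id
  have hψ : HolNear (fun x => x - φ x) (closedBall 0 r) := hid.sub hφ
  have hsph : ∀ x ∈ sphere (0 : ℂ) r, x - φ x ≠ 0 := fun x hx h => by
    have := hb x hx
    rw [← sub_eq_zero.1 h, mem_sphere_zero_iff_norm.1 hx] at this
    exact this.false
  -- Without a zero, x / (x - φ x) would be holomorphic with positive real part on the circle, yet
  -- it vanishes at 0.
  obtain ⟨z, hz, hzφ⟩ : ∃ z ∈ closedBall (0 : ℂ) r, z - φ z = 0 := by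
    by_contra! hne
    have := re_pos_of_re_pos_sphere hr ((hid.div hψ hne).diffContOnCl hr) (fun x hx => ?_) 0
      (mem_closedBall_self hr.le)
    · simp at this
    · have h1 := re_mul_conj_sub_pos (mem_sphere_zero_iff_norm.1 hx) (hb x hx)
      have h2 : 0 < normSq (x - φ x) := normSq_pos.2 (hsph x hx)
      have h3 : x / (x - φ x) = ((normSq (x - φ x))⁻¹ : ℝ) * (x * (starRingEnd ℂ) (x - φ x)) := by
        rw [div_eq_mul_inv, inv_def]; push_cast; ring
      rw [h3, re_ofReal_mul]
      refine mul_pos (inv_pos.2 h2) ?_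
      have : x * (starRingEnd ℂ) (x - φ x) = (starRingEnd ℂ) ((x - φ x) * (starRingEnd ℂ) x) := by
        rw [map_mul, conj_conj, mul_comm]
      rwa [this, conj_re]
  have hzb : z ∈ ball (0 : ℂ) r := by
    rw [mem_ball_zero_iff]
    refine lt_of_le_of_ne (mem_closedBall_zero_iff.1 hz) fun h => ?_
    exact hsph z (mem_sphere_zero_iff_norm.2 h) hzφ
  have hzr : ‖z‖ < r := mem_ball_zero_iff.1 hzb
  set k := dslope (fun x => x - φ x) z with hk
  have hkh : HolNear k (closedBall 0 r) := hψ.dslope z hz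
  have hkx : ∀ x, x - φ x = (x - z) * k x := fun x => by
    have := sub_smul_dslope (fun x => x - φ x) z x
    simpa [hzφ] using this.symm
  -- On the circle m y = y·conj(y - z), so k y / m y is a positive multiple of (y - φ y)·conj y. The
  -- minimum principle then makes `k` zero-free, which gives both uniqueness and simplicity of `z`.
  set m : ℂ → ℂ := fun x => r ^ 2 - (starRingEnd ℂ) z * x with hm
  have hm0 : ∀ x ∈ closedBall (0 : ℂ) r, m x ≠ 0 := fun x hx h => by
    have h1 : (r : ℂ) ^ 2 = (starRingEnd ℂ) z * x := sub_eq_zero.1 h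
    have h2 := congrArg norm h1
    rw [norm_mul, Complex.norm_conj, norm_pow, norm_real, Real.norm_of_nonneg hr.le] at h2
    have h3 := mem_closedBall_zero_iff.1 hx
    nlinarith [norm_nonneg z, norm_nonneg x]
  have hmh : HolNear m (closedBall 0 r) := .of_differentiable (by fun_prop)
  have hk0 : ∀ x ∈ closedBall (0 : ℂ) r, k x ≠ 0 := by
    intro x hx h0
    have := re_pos_of_re_pos_sphere hr ((hkh.div hmh hm0).diffContOnCl hr) (fun y hy => ?_) x hx
    · simp [h0] at this
    · have hy' := mem_sphere_zero_iff_norm.1 hy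
      have h1 := re_mul_conj_sub_pos hy' (hb y hy)
      have hyz : y - z ≠ 0 := fun h => by
        rw [sub_eq_zero] at h; rw [h] at hy'; exact hzr.ne hy'
      have hy0 : y ≠ 0 := fun h => by simp [h] at hy'; exact hr.ne hy'
      have hyy : y * (starRingEnd ℂ) y = r ^ 2 := by
        rw [mul_conj, normSq_eq_norm_sq, hy']; push_cast; ring
      have h2 : 0 < normSq (y - z) := normSq_pos.2 hyz
      have h3 : k y / m y =
          ((r ^ 2 * normSq (y - z))⁻¹ : ℝ) * ((y - φ y) * (starRingEnd ℂ) y) := by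
        have h4 : m y = y * (starRingEnd ℂ) (y - z) := by
          rw [map_sub, mul_sub, hyy, hm]; ring
        have h5 : (starRingEnd ℂ) (y - z) ≠ 0 := (map_ne_zero _).2 hyz
        have h6 : (starRingEnd ℂ) y ≠ 0 := (map_ne_zero _).2 hy0
        rw [h4, hkx y]
        push_cast
        rw [← mul_conj, ← hyy]
        field_simp
      rw [h3, re_ofReal_mul]
      exact mul_pos (inv_pos.2 (by positivity)) h1
  have hkz : k z = 1 - deriv φ z := by
    rw [hk, dslope_same, deriv_fun_sub differentiableAt_fun_id (hφ.differentiableAt hz)]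
    simp
  refine ⟨z, hzb, (sub_eq_zero.1 hzφ).symm, fun w hw hwφ => ?_, hkz ▸ hk0 z hz, fun F hF => ?_⟩
  · have h1 := hkx w
    rw [hwφ, sub_self] at h1
    exact sub_eq_zero.1 ((mul_eq_zero.1 h1.symm).resolve_right (hk0 w hw))
  -- Since x - φ x = (x - z) k x, the integral is Cauchy's formula for F/k at z.
  · have h1 := ((hF.div hkh hk0).diffContOnCl hr).two_pi_i_inv_smul_circleIntegral_sub_inv_smul hzb
    rw [hkz, smul_eq_mul] at h1
    rw [← h1]
    congr 1
    refine circleIntegral.integral_congr hr.le fun x hx => ?_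
    simp only [smul_eq_mul]
    rw [hkx x, div_eq_mul_inv, mul_inv, div_eq_mul_inv]
    ring

/-! ### Polydiscs, tori and slices along the first coordinate -/

/-- The closed polydisc of polyradius `r`. -/
def closedPolydisc (r : Fin n → ℝ) : Set (Fin n → ℂ) := {z | ∀ k, ‖z k‖ ≤ r k}

/-- The torus of polyradius `r`, the distinguished boundary of the polydisc. -/
def torus (r : Fin n → ℝ) : Set (Fin n → ℂ) := {z | ∀ k, ‖z k‖ = r k}

lemma torus_subset_closedPolydisc (r : Fin n → ℝ) : torus r ⊆ closedPolydisc r :=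
  fun _ hz k => (hz k).le

lemma polydisc_subset_closedPolydisc (r : Fin n → ℝ) : polydisc r ⊆ closedPolydisc r :=
  fun _ hz k => (hz k).le

lemma isCompact_closedPolydisc (r : Fin n → ℝ) : IsCompact (closedPolydisc r) := by
  have : closedPolydisc r = Set.pi univ fun k => closedBall (0 : ℂ) (r k) := by
    ext z; simp [closedPolydisc]
  rw [this]
  exact isCompact_univ_pi fun k => isCompact_closedBall _ _

lemma isCompact_torus (r : Fin n → ℝ) : IsCompact (torus r) := by
  have : torus r = Set.pi univ fun k => sphere (0 : ℂ) (r k) := by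
    ext z; simp [torus]
  rw [this]
  exact isCompact_univ_pi fun k => isCompact_sphere _ _

lemma isOpen_polydisc (r : Fin n → ℝ) : IsOpen (polydisc r) := by
  have : polydisc r = Set.pi univ fun k => ball (0 : ℂ) (r k) := by
    ext z; simp [polydisc]
  rw [this]
  exact isOpen_set_pi finite_univ fun k _ => isOpen_ball

lemma torusMap_mem_torus {r : Fin n → ℝ} (hr : ∀ k, 0 < r k) (θ : Fin n → ℝ) :
    torusMap 0 r θ ∈ torus r := fun k => by
  simp [torusMap, norm_exp_ofReal_mul_I, abs_of_pos (hr k)]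

lemma vecCons_mem_closedPolydisc {r : Fin (n + 1) → ℝ} {x : ℂ} {y : Fin n → ℂ} :
    vecCons x y ∈ closedPolydisc r ↔
      x ∈ closedBall (0 : ℂ) (r 0) ∧ y ∈ closedPolydisc fun k => r k.succ := by
  simp [closedPolydisc, Fin.forall_fin_succ]

lemma vecCons_mem_torus {r : Fin (n + 1) → ℝ} {x : ℂ} {y : Fin n → ℂ} :
    vecCons x y ∈ torus r ↔ x ∈ sphere (0 : ℂ) (r 0) ∧ y ∈ torus fun k => r k.succ := by
  simp [torus, Fin.forall_fin_succ]

lemma vecCons_mem_polydisc {r : Fin (n + 1) → ℝ} {x : ℂ} {y : Fin n → ℂ} :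
    vecCons x y ∈ polydisc r ↔ x ∈ ball (0 : ℂ) (r 0) ∧ y ∈ polydisc fun k => r k.succ := by
  simp [polydisc, Fin.forall_fin_succ]

lemma exists_eq_vecCons (z : Fin (n + 1) → ℂ) : ∃ x y, z = vecCons x y :=
  ⟨z 0, fun k => z k.succ, (Fin.cons_self_tail z).symm⟩

lemma differentiable_vecCons :
    Differentiable ℂ fun p : ℂ × (Fin n → ℂ) => (vecCons p.1 p.2 : Fin (n + 1) → ℂ) := by
  refine differentiable_pi.2 fun k => ?_
  refine Fin.cases ?_ (fun i => ?_) k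
  · simp only [cons_val_zero]
    fun_prop
  · simp only [cons_val_succ]
    fun_prop

lemma HolNear.uncurry_vecCons {f : (Fin (n + 1) → ℂ) → ℂ} {r : Fin (n + 1) → ℝ}
    (hf : HolNear f (closedPolydisc r)) :
    HolNear (fun p : ℂ × (Fin n → ℂ) => f (vecCons p.1 p.2))
      (closedBall 0 (r 0) ×ˢ closedPolydisc fun k => r k.succ) :=
  hf.comp differentiable_vecCons fun _ hp => vecCons_mem_closedPolydisc.2 hp

section Slices

variable {E : Type*} [NormedAddCommGroup E] [NormedSpace ℂ E] {G : ℂ × E → ℂ}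
  {A : Set ℂ} {B : Set E}

/-- A tube lemma: for compact factors, neighbourhoods of the product are generated by products of
neighbourhoods. -/
lemma HolNear.eventually_slice (hG : HolNear G (A ×ˢ B)) (hA : IsCompact A) (hB : IsCompact B) :
    ∀ᶠ x in 𝓝ˢ A, HolNear (fun y => G (x, y)) B := by
  rw [HolNear, hA.nhdsSet_prod_eq hB] at hG
  filter_upwards [hG.curry] with x hx
  filter_upwards [hx] with y hy
  exact hy.comp y ((differentiableAt_const x).prodMk differentiableAt_fun_id)

lemma HolNear.slice_right (hG : HolNear G (A ×ˢ B)) {x : ℂ} (hx : x ∈ A) :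
    HolNear (fun y => G (x, y)) B :=
  hG.comp (u := fun y => (x, y)) (by fun_prop) fun _ hy => ⟨hx, hy⟩

lemma HolNear.slice_left (hG : HolNear G (A ×ˢ B)) {y : E} (hy : y ∈ B) :
    HolNear (fun x => G (x, y)) A :=
  hG.comp (u := fun x => (x, y)) (by fun_prop) fun _ hx => ⟨hx, hy⟩

end Slices

/-- The maximum over the compact circle is attained, so the strict bound survives the maximum
principle. -/
lemma norm_lt_of_sphere {f : ℂ → ℂ} {r C : ℝ} (hr : 0 < r) (hf : HolNear f (closedBall 0 r))
    (h : ∀ x ∈ sphere (0 : ℂ) r, ‖f x‖ < C) : ∀ x ∈ closedBall (0 : ℂ) r, ‖f x‖ < C := by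
  intro x hx
  obtain ⟨x₀, hx₀, hmax⟩ := (isCompact_sphere (0 : ℂ) r).exists_isMaxOn
    (NormedSpace.sphere_nonempty.2 hr.le) (hf.mono sphere_subset_closedBall).continuousOn.norm
  refine lt_of_le_of_lt ?_ (h x₀ hx₀)
  refine norm_le_of_forall_mem_frontier_norm_le isBounded_ball (hf.diffContOnCl hr) (fun z hz => ?_)
    ((closure_ball (0 : ℂ) hr.ne').symm ▸ hx)
  rw [frontier_ball _ hr.ne'] at hz
  exact hmax hz

/-- The maximum principle on a polydisc. -/
lemma norm_lt_of_torus {C : ℝ} : ∀ {n : ℕ} {r : Fin n → ℝ} {f : (Fin n → ℂ) → ℂ},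
    (∀ k, 0 < r k) → HolNear f (closedPolydisc r) → (∀ z ∈ torus r, ‖f z‖ < C) →
      ∀ z ∈ closedPolydisc r, ‖f z‖ < C
  | 0, _, _, _, _, h, z, _ => h z fun k => k.elim0
  | n + 1, r, f, hr, hf, h, z, hz => by
    obtain ⟨x, y, rfl⟩ := exists_eq_vecCons z
    rw [vecCons_mem_closedPolydisc] at hz
    refine norm_lt_of_sphere (hr 0) (hf.uncurry_vecCons.slice_left hz.2) (fun x' hx' => ?_) x hz.1
    exact norm_lt_of_torus (fun k => hr k.succ)
      (hf.uncurry_vecCons.slice_right (sphere_subset_closedBall hx'))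
      (fun y' hy' => h _ (vecCons_mem_torus.2 ⟨hx', hy'⟩)) y hz.2

/-! ### Torus integrals depending on a parameter -/

/-- The normalised integral `(2πi)⁻ⁿ ∮ ⋯ ∮ f` over the torus of polyradius `r`. -/
noncomputable def torusAvg (r : Fin n → ℝ) (f : (Fin n → ℂ) → ℂ) : ℂ :=
  ((2 * π * I) ^ n)⁻¹ * torusIntegral f 0 r

lemma torusAvg_zero (r : Fin 0 → ℝ) (f : (Fin 0 → ℂ) → ℂ) : torusAvg r f = f 0 := by
  simp [torusAvg, torusIntegral_dim0]

lemma torusAvg_const_mul (r : Fin n → ℝ) (a : ℂ) (f : (Fin n → ℂ) → ℂ) :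
    torusAvg r (fun z => a * f z) = a * torusAvg r f := by
  rw [torusAvg, torusIntegral_const_mul, torusAvg]; ring

lemma continuous_comp_torusMap {r : Fin n → ℝ} (hr : ∀ k, 0 < r k) {f : (Fin n → ℂ) → ℂ}
    (hf : ContinuousOn f (torus r)) : Continuous fun θ => f (torusMap 0 r θ) :=
  hf.comp_continuous (by unfold torusMap; fun_prop) (torusMap_mem_torus hr)

lemma torusAvg_succ {r : Fin (n + 1) → ℝ} (hr : ∀ k, 0 < r k) {f : (Fin (n + 1) → ℂ) → ℂ}
    (hf : ContinuousOn f (torus r)) :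
    torusAvg r f = (2 * π * I)⁻¹ *
      ∮ x in C(0, r 0), torusAvg (fun k => r k.succ) fun y => f (vecCons x y) := by
  have hi : TorusIntegrable f 0 r :=
    (continuous_comp_torusMap hr hf).continuousOn.integrableOn_compact isCompact_Icc
  rw [torusAvg, torusIntegral_succ hi]
  simp only [torusAvg]
  rw [circleIntegral.integral_const_mul, ← mul_assoc, pow_succ', mul_inv]
  rfl

/-- Differentiation under the integral over the torus. -/
lemma differentiableAt_torusAvg {r : Fin n → ℝ} (hr : ∀ k, 0 < r k) {G : ℂ × (Fin n → ℂ) → ℂ}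
    {x₀ : ℂ} (hG : HolNear G ({x₀} ×ˢ torus r)) :
    DifferentiableAt ℂ (fun x => torusAvg r fun y => G (x, y)) x₀ := by
  rw [HolNear, isCompact_singleton.nhdsSet_prod_eq (isCompact_torus r), nhdsSet_singleton] at hG
  obtain ⟨ε, hε, hball⟩ := Metric.eventually_nhds_iff_ball.1
    (hG.curry.mono fun x hx => hx.self_of_nhdsSet)
  have hcont : ContinuousOn G (closedBall x₀ (ε / 2) ×ˢ torus r) := fun p hp =>
    (hball p.1 (closedBall_subset_ball (by linarith) hp.1) p.2 hp.2).continuousAt.continuousWithinAt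
  obtain ⟨C, hC⟩ := ((isCompact_closedBall x₀ (ε / 2)).prod
    (isCompact_torus r)).exists_bound_of_continuousOn hcont
  have hε4 : 0 < ε / 4 := by linarith
  have hdx : ∀ x ∈ ball x₀ (ε / 2), ∀ y ∈ torus r,
      DifferentiableAt ℂ (fun x => G (x, y)) x := fun x hx y hy =>
    (hball x (ball_subset_ball (by linarith) hx) y hy).comp x
      (differentiableAt_fun_id.prodMk (differentiableAt_const y))
  have hcy : ∀ x ∈ ball x₀ (ε / 2), ContinuousOn (fun y => G (x, y)) (torus r) := fun x hx =>
    hcont.comp (by fun_prop) fun y hy => ⟨ball_subset_closedBall hx, hy⟩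
  have hw : Continuous fun θ : Fin n → ℝ => (∏ i, r i * cexp (θ i * I) * I : ℂ) := by fun_prop
  set w := fun θ : Fin n → ℝ => (∏ i, r i * cexp (θ i * I) * I : ℂ) with hwdef
  have hwn : ∀ θ, ‖w θ‖ = ∏ i, r i := fun θ => by
    simp only [hwdef, norm_prod, norm_mul, norm_exp_ofReal_mul_I, norm_I, mul_one, norm_real]
    exact Finset.prod_congr rfl fun i _ => Real.norm_of_nonneg (hr i).le
  have hmeas : ∀ x ∈ ball x₀ (ε / 2), Continuous fun θ => w θ • G (x, torusMap 0 r θ) :=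
    fun x hx => hw.smul (continuous_comp_torusMap hr (hcy x hx))
  have h0 : x₀ ∈ ball x₀ (ε / 2) := mem_ball_self (by linarith)
  have hsub : ball x₀ (ε / 4) ⊆ ball x₀ (ε / 2) := ball_subset_ball (by linarith)
  -- The dominating constant is Cauchy's estimate on circles of radius ε/4 centred in the ball of
  -- radius ε/4: they stay where C bounds G.
  have key := hasDerivAt_integral_of_dominated_loc_of_deriv_le (𝕜 := ℂ)
    (μ := volume.restrict (Icc (0 : Fin n → ℝ) fun _ => 2 * π))
    (F := fun x θ => w θ • G (x, torusMap 0 r θ))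
    (F' := fun x θ => w θ • deriv (fun x => G (x, torusMap 0 r θ)) x)
    (bound := fun _ => (∏ i, r i) * (C / (ε / 4)))
    (ball_mem_nhds x₀ hε4)
    (by filter_upwards [ball_mem_nhds x₀ hε4] with x hx
        using (hmeas x (hsub hx)).aestronglyMeasurable)
    ((hmeas x₀ h0).continuousOn.integrableOn_compact isCompact_Icc)
    ?_ (ae_of_all _ fun θ x hx => ?_) ?_ (ae_of_all _ fun θ x hx => ?_)
  · simpa only [torusAvg, torusIntegral] using (key.2.differentiableAt.const_mul _)
  -- The derivative is a pointwise limit of difference quotients. These are known to be continuous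
  -- in θ only for x near x₀, so they are replaced by 0 elsewhere.
  · classical
    refine aestronglyMeasurable_of_tendsto_ae (𝓝[≠] x₀)
      (f := fun x θ => if x ∈ ball x₀ (ε / 2) then
        w θ • slope (fun x => G (x, torusMap 0 r θ)) x₀ x else 0) (fun x => ?_)
      (ae_of_all _ fun θ => ?_)
    · split_ifs with hx
      · refine (hw.smul ?_).aestronglyMeasurable
        simp only [slope_def_field]
        exact ((continuous_comp_torusMap hr (hcy x hx)).sub
          (continuous_comp_torusMap hr (hcy x₀ h0))).div_const _
      · exact aestronglyMeasurable_const
    · have h1 := (hdx x₀ h0 _ (torusMap_mem_torus hr θ)).hasDerivAt.tendsto_slope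
      refine ((tendsto_const_nhds (x := w θ)).smul h1).congr' ?_
      filter_upwards [nhdsWithin_le_nhds (ball_mem_nhds x₀ (show 0 < ε / 2 by linarith))] with x hx
      rw [if_pos hx]
  · rw [norm_smul, hwn]
    refine mul_le_mul_of_nonneg_left ?_ (Finset.prod_nonneg fun i _ => (hr i).le)
    have hcb : closedBall x (ε / 4) ⊆ ball x₀ (ε / 2) := fun x' hx' => by
      have h1 := mem_ball.1 hx
      have h2 := mem_closedBall.1 hx'
      exact mem_ball.2 (by linarith [dist_triangle x' x x₀])
    refine norm_deriv_le_of_forall_mem_sphere_norm_le hε4 ⟨fun x' hx' => ?_, fun x' hx' => ?_⟩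
      fun x' hx' => hC _ ⟨ball_subset_closedBall (hcb (sphere_subset_closedBall hx')),
        torusMap_mem_torus hr θ⟩
    · exact (hdx x' (hcb (ball_subset_closedBall hx')) _
        (torusMap_mem_torus hr θ)).differentiableWithinAt
    · rw [closure_ball _ hε4.ne'] at hx'
      exact (hdx x' (hcb hx') _ (torusMap_mem_torus hr θ)).continuousAt.continuousWithinAt
  · exact continuousOn_const.integrableOn_compact isCompact_Icc
  · exact (hdx x (hsub hx) _ (torusMap_mem_torus hr θ)).hasDerivAt.const_smul (w θ)

lemma HolNear.torusAvg {r : Fin n → ℝ} (hr : ∀ k, 0 < r k) {G : ℂ × (Fin n → ℂ) → ℂ}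
    {A : Set ℂ} (hA : IsCompact A) (hG : HolNear G (A ×ˢ torus r)) :
    HolNear (fun x => LagrangeSeries.torusAvg r fun y => G (x, y)) A := by
  obtain ⟨U, hU, hKU, hd⟩ := eventually_nhdsSet_iff_exists.1 hG
  have h1 : ∀ᶠ p in 𝓝ˢ (A ×ˢ torus r), p ∈ U := eventually_nhdsSet_iff_exists.2
    ⟨U, hU, hKU, fun _ h => h⟩
  rw [hA.nhdsSet_prod_eq (isCompact_torus r)] at h1
  filter_upwards [h1.curry] with x hx
  refine differentiableAt_torusAvg hr (eventually_nhdsSet_iff_exists.2 ⟨U, hU, ?_, hd⟩)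
  rintro ⟨x', y⟩ ⟨rfl, hy⟩
  exact hx.self_of_nhdsSet y hy

/-! ### Mixed partials and Cauchy's coefficient formula -/

lemma partialDeriv_succ_vecCons (j : Fin n) (x : ℂ) (h : (Fin (n + 1) → ℂ) → ℂ) :
    (fun y => partialDeriv j.succ h (vecCons x y)) = partialDeriv j fun y => h (vecCons x y) := by
  funext y
  simp only [partialDeriv, lineDeriv]
  congr 1
  funext t
  congr 1
  funext k
  refine Fin.cases ?_ (fun i => ?_) k
  · simp
  · simp [Pi.single_apply]

lemma partialDeriv_zero_vecCons (y : Fin n → ℂ) (h : (Fin (n + 1) → ℂ) → ℂ) :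
    (fun x => partialDeriv 0 h (vecCons x y)) = deriv fun x => h (vecCons x y) := by
  funext x
  have h1 : ∀ t : ℂ, vecCons x y + t • Pi.single 0 1 = (vecCons (x + t) y : Fin (n + 1) → ℂ) := by
    intro t
    funext k
    refine Fin.cases ?_ (fun i => ?_) k
    · simp
    · simp
  simp only [partialDeriv, lineDeriv, h1]
  rw [deriv_comp_const_add (f := fun x => h (vecCons x y)), add_zero]

lemma iterate_partialDeriv_succ_vecCons (j : Fin n) (x : ℂ) (m : ℕ)
    (h : (Fin (n + 1) → ℂ) → ℂ) :
    (fun y => (partialDeriv j.succ)^[m] h (vecCons x y)) =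
      (partialDeriv j)^[m] fun y => h (vecCons x y) :=
  Function.Semiconj.iterate_right (f := fun (h : (Fin (n + 1) → ℂ) → ℂ) y => h (vecCons x y))
    (partialDeriv_succ_vecCons j x) m h

lemma iterate_partialDeriv_zero_vecCons (x : ℂ) (y : Fin n → ℂ) (m : ℕ)
    (h : (Fin (n + 1) → ℂ) → ℂ) :
    (partialDeriv 0)^[m] h (vecCons x y) = iteratedDeriv m (fun x => h (vecCons x y)) x := by
  rw [iteratedDeriv_eq_iterate]
  exact congrFun (Function.Semiconj.iterate_right
    (f := fun (h : (Fin (n + 1) → ℂ) → ℂ) x => h (vecCons x y))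
    (partialDeriv_zero_vecCons y) m h) x

/-- The fold applies the derivatives in the first coordinate last, so they come out as an outer
one-variable derivative, with no commutation of partials and no smoothness. -/
lemma mixedPartial_succ (s : Fin (n + 1) → ℕ) (g : (Fin (n + 1) → ℂ) → ℂ) (x : ℂ)
    (y : Fin n → ℂ) :
    mixedPartial s g (vecCons x y) = iteratedDeriv (s 0)
      (fun x => mixedPartial (fun j => s j.succ) (fun y => g (vecCons x y)) y) x := by
  have key : ∀ (x : ℂ) (l : List (Fin n)),
      (fun y => l.foldr (fun j h => (partialDeriv j.succ)^[s j.succ] h) g (vecCons x y)) =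
        l.foldr (fun j h => (partialDeriv j)^[s j.succ] h) fun y => g (vecCons x y) := by
    intro x l
    induction l with
    | nil => rfl
    | cons j l ih =>
      simp only [List.foldr_cons]
      rw [iterate_partialDeriv_succ_vecCons, ih]
  rw [mixedPartial, List.finRange_succ, List.foldr_cons, iterate_partialDeriv_zero_vecCons,
    List.foldr_map]
  congr 1
  funext x
  exact congrFun (key x _) y

lemma monomial_ne_zero_of_mem_torus {r : Fin n → ℝ} (hr : ∀ k, 0 < r k) (s : Fin n → ℕ)
    {z : Fin n → ℂ} (hz : z ∈ torus r) : ∏ j, z j ^ (s j + 1) ≠ 0 :=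
  Finset.prod_ne_zero_iff.2 fun j _ => pow_ne_zero _ fun h => by
    have := hz j
    rw [h, norm_zero] at this
    exact (hr j).ne this

lemma HolNear.coord (j : Fin n) (K : Set (Fin n → ℂ)) : HolNear (fun z => z j) K :=
  .of_differentiable (by fun_prop)

lemma HolNear.monomial (s : Fin n → ℕ) (K : Set (Fin n → ℂ)) :
    HolNear (fun z => ∏ j, z j ^ s j) K :=
  .prod fun j => (HolNear.coord j K).pow (s j)

/-- Cauchy's formula for the Taylor coefficients of a holomorphic function on a polydisc. -/
lemma mixedPartial_eq_torusAvg : ∀ {n : ℕ} {r : Fin n → ℝ} (s : Fin n → ℕ)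
    {g : (Fin n → ℂ) → ℂ}, (∀ k, 0 < r k) → HolNear g (closedPolydisc r) →
      (∏ j, (1 / ((s j).factorial : ℂ))) * mixedPartial s g 0 =
        torusAvg r fun z => g z / ∏ j, z j ^ (s j + 1)
  | 0, r, s, g, _, _ => by
    simp [torusAvg_zero, mixedPartial]
  | n + 1, r, s, g, hr, hg => by
    set r' : Fin n → ℝ := fun k => r k.succ
    have hr' : ∀ k, 0 < r' k := fun k => hr k.succ
    set c : ℂ := ∏ j : Fin n, (1 / ((s j.succ).factorial : ℂ)) with hc
    have hc0 : c ≠ 0 := Finset.prod_ne_zero_iff.2 fun j _ =>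
      one_div_ne_zero (Nat.cast_ne_zero.2 (Nat.factorial_ne_zero _))
    set h : ℂ → ℂ := fun x => mixedPartial (fun j => s j.succ) (fun y => g (vecCons x y)) 0 with hh
    set T : ℂ → ℂ := fun x => torusAvg r' fun y => g (vecCons x y) / ∏ j, y j ^ (s j.succ + 1)
    have hU := hg.uncurry_vecCons
    -- Equality on a neighbourhood, not just at 0, is what allows differentiating it s 0 times.
    have hT : ∀ᶠ x in 𝓝ˢ (closedBall (0 : ℂ) (r 0)), c * h x = T x := by
      filter_upwards [hU.eventually_slice (isCompact_closedBall _ _)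
        (isCompact_closedPolydisc _)] with x hx
      exact mixedPartial_eq_torusAvg (fun j => s j.succ) hr' hx
    have hTh : HolNear T (closedBall (0 : ℂ) (r 0)) := by
      refine HolNear.torusAvg hr' (isCompact_closedBall _ _)
        (G := fun p => g (vecCons p.1 p.2) / ∏ j, p.2 j ^ (s j.succ + 1)) (.div
          (hU.mono (prod_mono_right (torus_subset_closedPolydisc r')))
          ((HolNear.monomial _ (torus r')).comp (u := Prod.snd) (by fun_prop) fun p hp => hp.2)
          fun p hp => monomial_ne_zero_of_mem_torus hr' _ hp.2)
    have hTe : iteratedDeriv (s 0) T 0 = c * iteratedDeriv (s 0) h 0 := by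
      rw [← iteratedDeriv_const_mul_field]
      refine (Filter.EventuallyEq.iteratedDeriv_eq _ ?_).symm
      exact hT.filter_mono (nhds_le_nhdsSet (mem_closedBall_self (hr 0).le))
    have h0 : (0 : Fin (n + 1) → ℂ) = vecCons 0 0 := by
      funext k; refine Fin.cases ?_ (fun i => ?_) k <;> simp
    have hcontR : ContinuousOn (fun z : Fin (n + 1) → ℂ => g z / ∏ j, z j ^ (s j + 1)) (torus r) :=
      ((hg.mono (torus_subset_closedPolydisc r)).div (HolNear.monomial _ _)
        fun z hz => monomial_ne_zero_of_mem_torus hr s hz).continuousOn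
    rw [torusAvg_succ hr hcontR, h0, mixedPartial_succ, Fin.prod_univ_succ, mul_assoc,
      ← hc, ← hh, ← hTe]
    have hcauchy := (hTh.diffContOnCl (hr 0)).circleIntegral_one_div_sub_center_pow_smul (hr 0) (s 0)
    have hint : (∮ x in C(0, r 0), torusAvg r' fun y =>
        g (vecCons x y) / ∏ j, vecCons x y j ^ (s j + 1)) =
          ∮ x in C(0, r 0), (1 / (x - 0) ^ (s 0 + 1)) • T x := by
      congr 1
      funext x
      rw [smul_eq_mul, ← torusAvg_const_mul]
      congr 1
      funext y
      rw [Fin.prod_univ_succ]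
      simp only [cons_val_zero, cons_val_succ, sub_zero, div_eq_mul_inv, mul_inv]
      ring
    rw [hint, hcauchy, smul_eq_mul]
    have h2 : (2 * π * I : ℂ) ≠ 0 := two_pi_I_ne_zero
    field_simp

/-! ### Fixed points in several variables -/

lemma HolNear.comp_of_mapsTo {E E' : Type*} [NormedAddCommGroup E] [NormedSpace ℂ E]
    [NormedAddCommGroup E'] [NormedSpace ℂ E'] {f : E → ℂ} {u : E' → E} {K : Set E} {A : Set E'}
    (hf : HolNear f K) (hu : ∀ᶠ x in 𝓝ˢ A, DifferentiableAt ℂ u x) (h : MapsTo u A K) :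
    HolNear (fun x => f (u x)) A := by
  have h1 : ∀ᶠ x in 𝓝ˢ A, DifferentiableAt ℂ f (u x) :=
    eventually_nhdsSet_iff_forall.2 fun x hx =>
      (hu.self_of_nhdsSet x hx).continuousAt.eventually
        (eventually_nhdsSet_iff_forall.1 hf (u x) (h hx))
  filter_upwards [h1, hu] with x h1 h2 using h1.comp x h2

lemma HolNear.congr {f g : ℂ → ℂ} {A : Set ℂ} (hf : HolNear f A)
    (h : ∀ᶠ x in 𝓝ˢ A, f x = g x) : HolNear g A := by
  obtain ⟨U, hU, hAU, hd⟩ := eventually_nhdsSet_iff_exists.1 (hf.and h)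
  refine eventually_nhdsSet_iff_exists.2 ⟨U, hU, hAU, fun x hx => ?_⟩
  refine (hd x hx).1.congr_of_eventuallyEq ?_
  filter_upwards [hU.mem_nhds hx] with y hy using (hd y hy).2.symm

lemma deriv_comp_eq_sum_partialDeriv {f : (Fin n → ℂ) → ℂ} {u : ℂ → Fin n → ℂ} {x : ℂ}
    (hf : DifferentiableAt ℂ f (u x)) (hu : DifferentiableAt ℂ u x) :
    deriv (fun t => f (u t)) x = ∑ k, partialDeriv k f (u x) * deriv (fun t => u t k) x := by
  have h1 : HasDerivAt u (fun k => deriv (fun t => u t k) x) x :=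
    hasDerivAt_pi.2 fun k => (differentiableAt_pi.1 hu k).hasDerivAt
  have h2 := (hf.hasFDerivAt.comp_hasDerivAt x h1).deriv
  refine (h2.trans (LinearMap.pi_apply_eq_sum_univ (fderiv ℂ f (u x)).toLinearMap _)).trans ?_
  refine Finset.sum_congr rfl fun k _ => ?_
  rw [partialDeriv, hf.lineDeriv_eq_fderiv, smul_eq_mul, mul_comm]
  have hk : (fun i => if k = i then (1 : ℂ) else 0) = Pi.single k 1 := by
    funext i
    simp [Pi.single_apply, eq_comm]
  rw [hk]
  rfl

/-- Column expansion of a determinant when a vector with first coordinate `1` is mapped to a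
multiple of the first basis vector. -/
lemma det_eq_mul_of_mulVec {R : Type*} [CommRing R] (J : Matrix (Fin (n + 1)) (Fin (n + 1)) R)
    (v : Fin (n + 1) → R) (hv : v 0 = 1) (h : ∀ i : Fin n, (J *ᵥ v) i.succ = 0) :
    J.det = (J *ᵥ v) 0 * (J.submatrix Fin.succ Fin.succ).det := by
  -- Replacing column 0 of `J` by `J *ᵥ v` multiplies the determinant by v 0 = 1; only the top entry
  -- of the new column is nonzero.
  have h1 : cramer J (J *ᵥ v) 0 = J.det := by
    rw [cramer_eq_adjugate_mulVec, mulVec_mulVec, adjugate_mul, smul_mulVec, one_mulVec]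
    simp [hv]
  rw [← h1, cramer_apply, det_succ_column_zero, Fin.sum_univ_succ]
  rw [Finset.sum_eq_zero fun i _ => by simp [h i]]
  simp only [Fin.val_zero, pow_zero, one_mul, updateCol_self, add_zero]
  congr 2

/-- `z` is the only fixed point of `φ` in the closed polydisc of polyradius `r`, lies in its
interior, is nondegenerate, and computes the multiple residue of `F / ∏ (ε_j - φ_j)`. -/
structure IsResidualPoint (r : Fin n → ℝ) (φ : Fin n → (Fin n → ℂ) → ℂ) (z : Fin n → ℂ) :
    Prop where
  mem : z ∈ polydisc r
  fixed : ∀ j, φ j z = z j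
  unique : ∀ w ∈ closedPolydisc r, (∀ j, φ j w = w j) → w = z
  det_ne_zero : (jacobian φ z).det ≠ 0
  torusAvg_eq : ∀ F : (Fin n → ℂ) → ℂ, HolNear F (closedPolydisc r) →
    torusAvg r (fun y => F y / ∏ j, (y j - φ j y)) = F z / (jacobian φ z).det

lemma prod_sub_ne_zero_of_mem_torus {r : Fin n → ℝ} {φ : Fin n → (Fin n → ℂ) → ℂ}
    (hb : ∀ z ∈ torus r, ∀ j, ‖φ j z‖ < r j) {z : Fin n → ℂ} (hz : z ∈ torus r) :
    ∏ j, (z j - φ j z) ≠ 0 :=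
  Finset.prod_ne_zero_iff.2 fun j _ h => by
    have := hb z hz j
    rw [← sub_eq_zero.1 h, hz j] at this
    exact this.false

/-- A holomorphic system strictly contracting the torus of polyradius `r` has a residual point. -/
theorem exists_isResidualPoint : ∀ {n : ℕ} {r : Fin n → ℝ} {φ : Fin n → (Fin n → ℂ) → ℂ},
    (∀ k, 0 < r k) → (∀ j, HolNear (φ j) (closedPolydisc r)) →
      (∀ z ∈ torus r, ∀ j, ‖φ j z‖ < r j) → ∃ z, IsResidualPoint r φ z
  | 0, r, φ, _, _, _ =>
    ⟨0, fun k => k.elim0, fun k => k.elim0, fun _ _ _ => Subsingleton.elim _ _, by simp,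
      fun F _ => by simp [torusAvg_zero]⟩
  | n + 1, r, φ, hr, hφ, hb => by
    set r' : Fin n → ℝ := fun k => r k.succ with hr'def
    have hr' : ∀ k, 0 < r' k := fun k => hr k.succ
    set A : Set ℂ := closedBall 0 (r 0) with hAdef
    have hA : IsCompact A := isCompact_closedBall _ _
    have hK := isCompact_closedPolydisc r'
    have hT := isCompact_torus r'
    set ψ : ℂ → Fin n → (Fin n → ℂ) → ℂ := fun x j y => φ j.succ (vecCons x y) with hψ
    have hφU : ∀ j, HolNear (fun p : ℂ × (Fin n → ℂ) => φ j (vecCons p.1 p.2))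
      (A ×ˢ closedPolydisc r') := fun j => (hφ j).uncurry_vecCons
    -- The maximum principle in x carries the bound from the circle to the whole disc, so the
    -- inductive hypothesis applies to every slice.
    have hψb : ∀ x ∈ A, ∀ y ∈ torus r', ∀ j, ‖ψ x j y‖ < r' j := fun x hx y hy j =>
      norm_lt_of_sphere (hr 0)
        ((hφU j.succ).slice_left (torus_subset_closedPolydisc r' hy))
        (fun x' hx' => hb _ (vecCons_mem_torus.2 ⟨hx', hy⟩) j.succ) x hx
    have hψh : ∀ᶠ x in 𝓝ˢ A, ∀ j, HolNear (ψ x j) (closedPolydisc r') :=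
      eventually_all.2 fun j => (hφU j.succ).eventually_slice hA hK
    have hψb' : ∀ᶠ x in 𝓝ˢ A, ∀ y ∈ torus r', ∀ j, ‖ψ x j y‖ < r' j := by
      have h1 : ∀ᶠ p in 𝓝ˢ (A ×ˢ torus r'), ∀ j, ‖ψ p.1 j p.2‖ < r' j := by
        refine eventually_all.2 fun j => eventually_nhdsSet_iff_forall.2 fun p hp => ?_
        exact ((hφU j.succ).differentiableAt
          ⟨hp.1, torus_subset_closedPolydisc r' hp.2⟩).continuousAt.norm.eventually_lt_const
          (hψb p.1 hp.1 p.2 hp.2 j)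
      rw [hA.nhdsSet_prod_eq hT] at h1
      filter_upwards [h1.curry] with x hx y hy using hx.self_of_nhdsSet y hy
    -- A bare choice of fixed point; its regularity in x is recovered from the integrals below.
    set ζ : ℂ → Fin n → ℂ := fun x => Classical.epsilon (IsResidualPoint r' (ψ x)) with hζdef
    have hζ : ∀ᶠ x in 𝓝ˢ A, IsResidualPoint r' (ψ x) (ζ x) := by
      filter_upwards [hψh, hψb'] with x h1 h2
      exact Classical.epsilon_spec (exists_isResidualPoint hr' h1 h2)
    have hζA : ∀ x ∈ A, IsResidualPoint r' (ψ x) (ζ x) := hζ.self_of_nhdsSet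
    set D : ℂ → ℂ := fun x => (jacobian (ψ x) (ζ x)).det with hD
    -- By induction this quotient is the inner residue integral, whose integrand is holomorphic in
    -- x.
    have hquot : ∀ H : (Fin (n + 1) → ℂ) → ℂ, HolNear H (closedPolydisc r) →
        HolNear (fun x => H (vecCons x (ζ x)) / D x) A := by
      intro H hH
      have h1 : HolNear (fun x => torusAvg r' fun y =>
          H (vecCons x y) / ∏ j, (y j - ψ x j y)) A := by
        refine HolNear.torusAvg hr' hA
          (G := fun p => H (vecCons p.1 p.2) / ∏ j, (p.2 j - ψ p.1 j p.2)) (.div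
          (hH.uncurry_vecCons.mono (prod_mono_right (torus_subset_closedPolydisc r')))
          (.prod fun j => .sub (.of_differentiable (by fun_prop))
            ((hφU j.succ).mono (prod_mono_right (torus_subset_closedPolydisc r'))))
          fun p hp => prod_sub_ne_zero_of_mem_torus (hψb p.1 hp.1) hp.2)
      refine h1.congr ?_
      filter_upwards [hζ, hH.uncurry_vecCons.eventually_slice hA hK] with x h2 h3
      exact h2.torusAvg_eq _ h3
    have hDinv : HolNear (fun x => 1 / D x) A :=
      hquot (fun _ => 1) (.of_differentiable (by fun_prop))
    have hD0 : ∀ᶠ x in 𝓝ˢ A, D x ≠ 0 := hζ.mono fun x hx => hx.det_ne_zero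
    -- ζ_k = (ζ_k / D) / (1 / D).
    have hζh : ∀ k, HolNear (fun x => ζ x k) A := fun k => by
      refine ((hquot (fun z => z k.succ) (.coord _ _)).div hDinv
        fun x hx => one_div_ne_zero (hζA x hx).det_ne_zero).congr ?_
      filter_upwards [hD0] with x hx
      simp only [cons_val_succ]
      field_simp
    set u : ℂ → Fin (n + 1) → ℂ := fun x => vecCons x (ζ x) with hu
    have hud : ∀ᶠ x in 𝓝ˢ A, DifferentiableAt ℂ u x := by
      filter_upwards [eventually_all.2 hζh] with x hx
      exact (differentiable_vecCons (x, ζ x)).comp x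
        (differentiableAt_fun_id.prodMk (differentiableAt_pi.2 hx))
    have huA : MapsTo u A (closedPolydisc r) := fun x hx =>
      vecCons_mem_closedPolydisc.2 ⟨hx, polydisc_subset_closedPolydisc _ (hζA x hx).mem⟩
    have hφ0 : ∀ x ∈ sphere (0 : ℂ) (r 0), ∀ y ∈ closedPolydisc r', ‖φ 0 (vecCons x y)‖ < r 0 :=
      fun x hx => norm_lt_of_torus hr' ((hφU 0).slice_right (sphere_subset_closedBall hx))
        fun y hy => hb _ (vecCons_mem_torus.2 ⟨hx, hy⟩) 0
    obtain ⟨z₀, hz₀, hfix, huniq, hder, hres⟩ := fixedPoint_disc (φ := fun x => φ 0 (u x)) (hr 0)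
      ((hφ 0).comp_of_mapsTo hud huA)
      fun x hx => hφ0 x hx _ (huA (sphere_subset_closedBall hx) |> vecCons_mem_closedPolydisc.1).2
    have hz₀A : z₀ ∈ A := ball_subset_closedBall hz₀
    have hS := hζA z₀ hz₀A
    have hdet : (jacobian φ (u z₀)).det = (1 - deriv (fun x => φ 0 (u x)) z₀) * D z₀ := by
      -- `v` is the tangent of the curve x ↦ (x, ζ x). Differentiating φ_i = z_i along the curve,
      -- for every i but the first, shows that the Jacobian sends `v` to a multiple of the first
      -- basis vector.
      set v : Fin (n + 1) → ℂ := fun k => deriv (fun t => u t k) z₀ with hv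
      have hmul : ∀ i, (jacobian φ (u z₀) *ᵥ v) i = v i - deriv (fun x => φ i (u x)) z₀ := by
        intro i
        rw [deriv_comp_eq_sum_partialDeriv ((hφ i).differentiableAt (huA hz₀A))
          (hud.self_of_nhdsSet z₀ hz₀A)]
        simp [mulVec, dotProduct, jacobian, sub_mul, Finset.sum_sub_distrib, hv]
      have hv0 : v 0 = 1 := by simp [hv, hu]
      have hsucc : ∀ i : Fin n, (jacobian φ (u z₀) *ᵥ v) i.succ = 0 := fun i => by
        rw [hmul, sub_eq_zero]
        refine Filter.EventuallyEq.deriv_eq ?_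
        filter_upwards [hζ.filter_mono (nhds_le_nhdsSet hz₀A)] with x hx
        exact (hx.fixed i).symm
      rw [det_eq_mul_of_mulVec _ v hv0 hsucc, hmul, hv0]
      congr 2
      ext i j
      simp only [submatrix_apply, jacobian, of_apply, Fin.succ_inj]
      congr 1
      exact congrFun (partialDeriv_succ_vecCons j z₀ (φ i.succ)) (ζ z₀)
    refine ⟨u z₀, vecCons_mem_polydisc.2 ⟨hz₀, hS.mem⟩, Fin.cases hfix hS.fixed,
      fun w hw hwf => ?_, hdet ▸ mul_ne_zero hder hS.det_ne_zero, fun F hF => ?_⟩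
    · obtain ⟨x, y, rfl⟩ := exists_eq_vecCons w
      obtain ⟨hx, hy⟩ := vecCons_mem_closedPolydisc.1 hw
      have h1 : y = ζ x := (hζA x hx).unique y hy fun j => hwf j.succ
      subst h1
      rw [huniq x hx (hwf 0)]
    · rw [torusAvg_succ hr, hdet, mul_comm (1 - _), ← div_div,
        ← hres (fun x => F (u x) / D x) (hquot F hF)]
      · congr 1
        refine circleIntegral.integral_congr (hr 0).le fun x hx => ?_
        have hxA : x ∈ A := sphere_subset_closedBall hx
        -- For |x| = r 0 the factor x - φ 0 has no zero on the closed inner polydisc, so it can join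
        -- the numerator in the inductive residue formula.
        have hF' : HolNear (fun y => F (vecCons x y) / (x - φ 0 (vecCons x y)))
            (closedPolydisc r') := by
          refine (hF.uncurry_vecCons.slice_right hxA).div
            (.sub (.of_differentiable (by fun_prop)) ((hφU 0).slice_right hxA)) fun y hy h => ?_
          have h1 := hφ0 x hx y hy
          rw [← sub_eq_zero.1 h, mem_sphere_zero_iff_norm.1 hx] at h1
          exact h1.false
        rw [div_right_comm]
        refine Eq.trans ?_ ((hζA x hxA).torusAvg_eq _ hF')
        congr 1
        funext y
        rw [Fin.prod_univ_succ, ← div_div]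
        rfl
      · exact ((hF.mono (torus_subset_closedPolydisc r)).div
          (.prod fun j => .sub (.coord j _) ((hφ j).mono (torus_subset_closedPolydisc r)))
          fun z hz => prod_sub_ne_zero_of_mem_torus hb hz).continuousOn

/-! ### Summing the series under the integral -/

/-- The multiple geometric series. -/
lemma hasSum_prod_geometric {𝕜 : Type*} [NormedField 𝕜] [CompleteSpace 𝕜] :
    ∀ {n : ℕ} {w : Fin n → 𝕜}, (∀ j, ‖w j‖ < 1) →
      (Summable fun s : Fin n → ℕ => ‖∏ j, w j ^ s j‖) ∧
        HasSum (fun s : Fin n → ℕ => ∏ j, w j ^ s j) (∏ j, (1 - w j)⁻¹)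
  | 0, w, _ => by
    refine ⟨(hasSum_fintype _).summable, ?_⟩
    have := hasSum_unique fun s : Fin 0 → ℕ => ∏ j, w j ^ s j
    simpa only [Finset.univ_eq_empty, Finset.prod_empty] using this
  | n + 1, w, hw => by
    obtain ⟨h1, h2⟩ := hasSum_prod_geometric fun j : Fin n => hw j.succ
    have h3 : Summable fun m : ℕ => ‖w 0 ^ m‖ := summable_norm_geometric_of_norm_lt_one (hw 0)
    have h4 := h3.mul_norm h1
    have h5 := (hasSum_geometric_of_norm_lt_one (hw 0)).mul h2 h4.of_norm
    let e := Fin.consEquiv fun _ : Fin (n + 1) => ℕ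
    have he : ∀ p, ∏ j, w j ^ e p j = w 0 ^ p.1 * ∏ j : Fin n, w j.succ ^ p.2 j := fun p => by
      rw [Fin.prod_univ_succ]; rfl
    rw [← e.summable_iff, ← e.hasSum_iff, Fin.prod_univ_succ]
    simp only [Function.comp_def, he]
    exact ⟨h4, h5⟩

lemma torus_nonempty {r : Fin n → ℝ} (hr : ∀ k, 0 < r k) : (torus r).Nonempty :=
  ⟨_, torusMap_mem_torus hr 0⟩

/-- Termwise integration of the multiple geometric series over the torus. -/
lemma hasSum_torusAvg {r : Fin n → ℝ} (hr : ∀ k, 0 < r k) {φ : Fin n → (Fin n → ℂ) → ℂ}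
    {F : (Fin n → ℂ) → ℂ} (hφ : ∀ j, ContinuousOn (φ j) (torus r)) (hF : ContinuousOn F (torus r))
    (hb : ∀ z ∈ torus r, ∀ j, ‖φ j z‖ < r j) :
    (Summable fun s : Fin n → ℕ =>
      ‖torusAvg r fun z => ((∏ j, φ j z ^ s j) * F z) / ∏ j, z j ^ (s j + 1)‖) ∧
    HasSum (fun s : Fin n → ℕ =>
      torusAvg r fun z => ((∏ j, φ j z ^ s j) * F z) / ∏ j, z j ^ (s j + 1))
      (torusAvg r fun z => F z / ∏ j, (z j - φ j z)) := by
  -- Compactness gives one ratio below 1 for the whole torus, hence a summable majorant independent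
  -- of z.
  have hq : ∀ j, ∃ q : ℝ, 0 ≤ q ∧ q < 1 ∧ ∀ z ∈ torus r, ‖φ j z / z j‖ ≤ q := by
    intro j
    obtain ⟨z₀, hz₀, hmax⟩ := (isCompact_torus r).exists_isMaxOn (torus_nonempty hr) (hφ j).norm
    refine ⟨‖φ j z₀‖ / r j, div_nonneg (norm_nonneg _) (hr j).le,
      (div_lt_one (hr j)).2 (hb z₀ hz₀ j), fun z hz => ?_⟩
    rw [norm_div, hz j]
    exact div_le_div_of_nonneg_right (hmax hz) (hr j).le
  choose q hq0 hq1 hq using hq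
  have hne : ∀ z ∈ torus r, ∀ j, z j ≠ 0 := fun z hz j h => by
    have := hz j
    rw [h, norm_zero] at this
    exact (hr j).ne this
  have hcoord : ContinuousOn (fun z : Fin n → ℂ => ∏ j, z j) (torus r) :=
    Continuous.continuousOn (by fun_prop)
  obtain ⟨C, hC⟩ := (isCompact_torus r).exists_bound_of_continuousOn
    (hF.div hcoord fun z hz => Finset.prod_ne_zero_iff.2 fun j _ => hne z hz j)
  have hsplit : ∀ z (s : Fin n → ℕ), ((∏ j, φ j z ^ s j) * F z) / ∏ j, z j ^ (s j + 1) =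
      (∏ j, (φ j z / z j) ^ s j) * (F z / ∏ j, z j) := fun z s => by
    simp only [pow_succ, Finset.prod_mul_distrib, div_pow, Finset.prod_div_distrib]
    rw [mul_div_mul_comm]
  have hbound : ∀ z ∈ torus r, ∀ s : Fin n → ℕ,
      ‖((∏ j, φ j z ^ s j) * F z) / ∏ j, z j ^ (s j + 1)‖ ≤ (∏ j, q j ^ s j) * C := by
    intro z hz s
    rw [hsplit, norm_mul, norm_prod]
    refine mul_le_mul (Finset.prod_le_prod (fun j _ => norm_nonneg _) fun j _ => ?_) (hC z hz)
      (norm_nonneg _) (Finset.prod_nonneg fun j _ => pow_nonneg (hq0 j) _)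
    rw [norm_pow]
    exact pow_le_pow_left₀ (norm_nonneg _) (hq j z hz) _
  have hqs : Summable fun s : Fin n → ℕ => ∏ j, q j ^ s j :=
    (hasSum_prod_geometric fun j => by rw [Real.norm_of_nonneg (hq0 j)]; exact hq1 j).2.summable
  have hcont : ∀ s : Fin n → ℕ, ContinuousOn
      (fun z => ((∏ j, φ j z ^ s j) * F z) / ∏ j, z j ^ (s j + 1)) (torus r) := fun s =>
    ((continuousOn_finsetProd _ fun j _ => (hφ j).pow _).mul hF).div
      (Continuous.continuousOn (by fun_prop)) fun z hz => monomial_ne_zero_of_mem_torus hr s hz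
  have hlim : ∀ z ∈ torus r, HasSum
      (fun s : Fin n → ℕ => ((∏ j, φ j z ^ s j) * F z) / ∏ j, z j ^ (s j + 1))
      (F z / ∏ j, (z j - φ j z)) := by
    intro z hz
    have h1 := (hasSum_prod_geometric fun j => (hq j z hz).trans_lt (hq1 j)).2.mul_right
      (F z / ∏ j, z j)
    simp only [hsplit]
    have h2 : ∏ j, (z j - φ j z) = (∏ j, (1 - φ j z / z j)) * ∏ j, z j := by
      rw [← Finset.prod_mul_distrib]
      refine Finset.prod_congr rfl fun j _ => ?_
      rw [sub_mul, one_mul, div_mul_cancel₀ _ (hne z hz j)]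
    have h3 : F z / ∏ j, (z j - φ j z) = (∏ j, (1 - φ j z / z j)⁻¹) * (F z / ∏ j, z j) := by
      rw [h2, Finset.prod_inv_distrib, div_eq_mul_inv, mul_inv, div_eq_mul_inv]
      ring
    rwa [h3]
  constructor
  · refine Summable.of_nonneg_of_le (fun _ => norm_nonneg _) (fun s => ?_)
      (hqs.mul_left (‖((2 * π * I : ℂ) ^ n)⁻¹‖ * (((2 * π) ^ n * ∏ i, |r i|) * C)))
    rw [torusAvg, norm_mul, mul_assoc ‖((2 * π * I : ℂ) ^ n)⁻¹‖]
    refine mul_le_mul_of_nonneg_left ?_ (norm_nonneg _)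
    refine (norm_torusIntegral_le_of_norm_le_const fun θ =>
      hbound _ (torusMap_mem_torus hr θ) s).trans_eq (by ring)
  · refine HasSum.mul_left _ ?_
    refine hasSum_integral_of_dominated_convergence
      (fun s _ => (∏ i, |r i|) * ((∏ j, q j ^ s j) * C)) (fun s => ?_)
      (fun s => ae_of_all _ fun θ => ?_) (ae_of_all _ fun θ => ?_) ?_ (ae_of_all _ fun θ => ?_)
    · have hw : Continuous fun θ : Fin n → ℝ => (∏ i, r i * cexp (θ i * I) * I : ℂ) := by fun_prop
      exact (hw.smul (continuous_comp_torusMap hr (hcont s))).aestronglyMeasurable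
    · rw [norm_smul]
      refine mul_le_mul (le_of_eq ?_) (hbound _ (torusMap_mem_torus hr θ) s) (norm_nonneg _)
        (Finset.prod_nonneg fun _ _ => abs_nonneg _)
      simp
    · exact (hqs.mul_right C).mul_left _
    · exact continuousOn_const.integrableOn_compact isCompact_Icc
    · exact (hlim _ (torusMap_mem_torus hr θ)).const_smul _

/-- The multiple Lagrange series of `φ` and `F` at the fixed point `z` of `φ`. -/
theorem IsResidualPoint.hasSum_term {r : Fin n → ℝ} (hr : ∀ k, 0 < r k)
    {φ : Fin n → (Fin n → ℂ) → ℂ} (hφ : ∀ j, HolNear (φ j) (closedPolydisc r))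
    (hb : ∀ z ∈ torus r, ∀ j, ‖φ j z‖ < r j) {z : Fin n → ℂ} (hz : IsResidualPoint r φ z)
    {F : (Fin n → ℂ) → ℂ} (hF : HolNear F (closedPolydisc r)) :
    (Summable fun s : Fin n → ℕ => ‖term φ F s‖) ∧
      HasSum (fun s : Fin n → ℕ => term φ F s) (F z / (jacobian φ z).det) := by
  have hterm : ∀ s, term φ F s =
      torusAvg r fun z => ((∏ j, φ j z ^ s j) * F z) / ∏ j, z j ^ (s j + 1) := fun s =>
    mixedPartial_eq_torusAvg s hr (.mul (.prod fun j => (hφ j).pow _) hF)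
  simp only [hterm]
  rw [← hz.torusAvg_eq F hF]
  have hsub := torus_subset_closedPolydisc r
  exact hasSum_torusAvg hr (fun j => (hφ j).continuousOn.mono hsub) (hF.continuousOn.mono hsub) hb

/-! ### Passage to the stated hypotheses and the case of linear forms -/

lemma HolNear.of_differentiableOn_polydisc {r r₀ : Fin n → ℝ} (h : ∀ k, r k < r₀ k)
    {f : (Fin n → ℂ) → ℂ} (hf : DifferentiableOn ℂ f (polydisc r₀)) :
    HolNear f (closedPolydisc r) :=
  eventually_nhdsSet_iff_exists.2 ⟨polydisc r₀, isOpen_polydisc r₀,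
    fun _ hz k => (hz k).trans_lt (h k), fun _ hx =>
      hf.differentiableAt ((isOpen_polydisc r₀).mem_nhds hx)⟩

/-- Scaling and translation rules for `deriv` hold without differentiability. If θ(μ_k, μ_j) = 0
both sides vanish, whatever value `deriv f` takes there. -/
lemma partialDeriv_comp_linForm (f : ℂ → ℂ) (θ : ℂ → ℂ → ℂ) (μ : Fin n → ℂ) (j k : Fin n)
    (z : Fin n → ℂ) : partialDeriv k (fun ε => f (linForm θ μ j ε)) z =
      θ (μ k) (μ j) * deriv f (linForm θ μ j z) := by
  have h1 : ∀ t : ℂ, linForm θ μ j (z + t • Pi.single k 1) =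
      linForm θ μ j z + θ (μ k) (μ j) * t := fun t => by
    simp [linForm, add_mul, Finset.sum_add_distrib, Pi.single_apply, mul_comm t]
  simp only [partialDeriv, lineDeriv, h1]
  rw [deriv_comp_mul_left (θ (μ k) (μ j)) (fun t => f (linForm θ μ j z + t)), mul_zero,
    deriv_comp_const_add, add_zero, smul_eq_mul]

lemma jacobian_comp_linForm (f : ℂ → ℂ) (θ : ℂ → ℂ → ℂ) (μ : Fin n → ℂ) (z : Fin n → ℂ) :
    jacobian (fun j ε => f (linForm θ μ j ε)) z =
      Matrix.of fun j k : Fin n => (if j = k then (1 : ℂ) else 0) -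
        θ (μ k) (μ j) * deriv f (∑ a, z a * θ (μ a) (μ j)) := by
  ext j k
  simp only [jacobian, of_apply, partialDeriv_comp_linForm]
  rfl

end LagrangeSeries

theorem propositionC2 (N : ℕ) (r₀ r : Fin N → ℝ)
    (hr : ∀ k, 0 < r k) (hr₀ : ∀ k, r k < r₀ k) :
    -- the general multiple Lagrange series
    (∀ φ : Fin N → (Fin N → ℂ) → ℂ,
      (∀ j, DifferentiableOn ℂ (φ j) (LagrangeSeries.polydisc r₀)) →
      (∀ z : Fin N → ℂ, (∀ k, ‖z k‖ = r k) → ∀ j, ‖φ j z‖ < r j) →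
      ∃ z ∈ LagrangeSeries.polydisc r,
        (∀ j, z j - φ j z = 0) ∧
        (∀ w ∈ LagrangeSeries.polydisc r, (∀ j, w j - φ j w = 0) → w = z) ∧
        (LagrangeSeries.jacobian φ z).det ≠ 0 ∧
        ∀ F : (Fin N → ℂ) → ℂ, DifferentiableOn ℂ F (LagrangeSeries.polydisc r₀) →
          Summable (fun s : Fin N → ℕ => ‖LagrangeSeries.term φ F s‖) ∧
          HasSum (fun s : Fin N → ℕ => LagrangeSeries.term φ F s)
            (F z / (LagrangeSeries.jacobian φ z).det)) ∧
    -- the special case `φ_j(ε) = f (∑_a ε_a θ(μ_a, μ_j))`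
    (∀ (f : ℂ → ℂ) (θ : ℂ → ℂ → ℂ) (μ : Fin N → ℂ),
      (∀ j, DifferentiableOn ℂ (fun ε => f (LagrangeSeries.linForm θ μ j ε))
        (LagrangeSeries.polydisc r₀)) →
      (∀ z : Fin N → ℂ, (∀ k, ‖z k‖ = r k) →
        ∀ j, ‖f (LagrangeSeries.linForm θ μ j z)‖ < r j) →
      ∃ z ∈ LagrangeSeries.polydisc r,
        (∀ j, z j - f (∑ a, z a * θ (μ a) (μ j)) = 0) ∧
        (∀ w ∈ LagrangeSeries.polydisc r,
          (∀ j, w j - f (∑ a, w a * θ (μ a) (μ j)) = 0) → w = z) ∧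
        (Matrix.of fun j k : Fin N => (if j = k then (1 : ℂ) else 0) -
          θ (μ k) (μ j) * deriv f (∑ a, z a * θ (μ a) (μ j))).det ≠ 0 ∧
        -- with an arbitrary holomorphic `F`
        (∀ F : (Fin N → ℂ) → ℂ, DifferentiableOn ℂ F (LagrangeSeries.polydisc r₀) →
          Summable (fun s : Fin N → ℕ => ‖LagrangeSeries.term
            (fun j ε => f (LagrangeSeries.linForm θ μ j ε)) F s‖) ∧
          HasSum (fun s : Fin N → ℕ => LagrangeSeries.term
            (fun j ε => f (LagrangeSeries.linForm θ μ j ε)) F s)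
            (F z / (Matrix.of fun j k : Fin N => (if j = k then (1 : ℂ) else 0) -
              θ (μ k) (μ j) * deriv f (∑ a, z a * θ (μ a) (μ j))).det)) ∧
        -- with `F` a function of the sums built from `g⁽¹⁾, g⁽²⁾, …`
        (∀ (F : (ℕ → ℂ) → ℂ) (g : (m : ℕ) → (Fin (m + 1) → ℂ) → ℂ),
          DifferentiableOn ℂ (fun ε => F (LagrangeSeries.structArg μ g ε))
            (LagrangeSeries.polydisc r₀) →
          Summable (fun s : Fin N → ℕ => ‖LagrangeSeries.term
            (fun j ε => f (LagrangeSeries.linForm θ μ j ε))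
            (fun ε => F (LagrangeSeries.structArg μ g ε)) s‖) ∧
          HasSum (fun s : Fin N → ℕ => LagrangeSeries.term
            (fun j ε => f (LagrangeSeries.linForm θ μ j ε))
            (fun ε => F (LagrangeSeries.structArg μ g ε)) s)
            (F (LagrangeSeries.structArg μ g z) /
              (Matrix.of fun j k : Fin N => (if j = k then (1 : ℂ) else 0) -
                θ (μ k) (μ j) * deriv f (∑ a, z a * θ (μ a) (μ j))).det))) := by
  have general : ∀ φ : Fin N → (Fin N → ℂ) → ℂ,
      (∀ j, DifferentiableOn ℂ (φ j) (LagrangeSeries.polydisc r₀)) →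
      (∀ z : Fin N → ℂ, (∀ k, ‖z k‖ = r k) → ∀ j, ‖φ j z‖ < r j) →
      ∃ z ∈ LagrangeSeries.polydisc r,
        (∀ j, z j - φ j z = 0) ∧
        (∀ w ∈ LagrangeSeries.polydisc r, (∀ j, w j - φ j w = 0) → w = z) ∧
        (LagrangeSeries.jacobian φ z).det ≠ 0 ∧
        ∀ F : (Fin N → ℂ) → ℂ, DifferentiableOn ℂ F (LagrangeSeries.polydisc r₀) →
          Summable (fun s : Fin N → ℕ => ‖LagrangeSeries.term φ F s‖) ∧
          HasSum (fun s : Fin N → ℕ => LagrangeSeries.term φ F s)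
            (F z / (LagrangeSeries.jacobian φ z).det) := by
    intro φ hφ hb
    have hφ' := fun j => LagrangeSeries.HolNear.of_differentiableOn_polydisc hr₀ (hφ j)
    obtain ⟨z, hz⟩ := LagrangeSeries.exists_isResidualPoint hr hφ' hb
    exact ⟨z, hz.mem, fun j => sub_eq_zero.2 (hz.fixed j).symm,
      fun w hw h => hz.unique w (LagrangeSeries.polydisc_subset_closedPolydisc r hw)
        fun j => (sub_eq_zero.1 (h j)).symm,
      hz.det_ne_zero, fun F hF =>
        hz.hasSum_term hr hφ' hb (.of_differentiableOn_polydisc hr₀ hF)⟩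
  refine ⟨general, fun f θ μ hφ hb => ?_⟩
  obtain ⟨z, hz, hfix, huniq, hdet, hsum⟩ := general _ hφ hb
  rw [LagrangeSeries.jacobian_comp_linForm] at hdet hsum
  exact ⟨z, hz, hfix, huniq, hdet, hsum, fun F g hF => hsum _ hF⟩
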